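/- Let $X$ be a locally compact, connected Hausdorff space. A deficient topological measure on $X$ is a set function $\mu$ from the open and closed subsets of $X$ to $[0,\infty]$, not identically $\infty$, such that $\mu(C\sqcup K)=\mu(C)+\mu(K)$ for disjoint compact $C,K$; $\mu(U)=\sup\{\mu(K):K\subseteq U,\ K\text{ compact}\}$ for $U$ open; $\mu(F)=\inf\{\mu(U):F\subseteq U,\ U\text{ open}\}$ for $F$ closed. It is a topological measure if, in addition, $\mu(A\sqcup B)=\mu(A)+\mu(B)$ for disjoint $A,B$ whenever each of $A$, $B$, $A\sqcup B$ is compact or open. It is finite if $\mu(X)<\infty$. For a finite deficient topological measure $\mu$ and a bounded continuous $f:X\to\mathbb R$ put $R_1(t)=\mu(f^{-1}((t,\infty)))$, let $r=r_{\mu,f}$ be the Lebesgue–Stieltjes measure on $\mathbb R$ associated with $-R_1$, and let $\int_X f\,d\mu=\int_{\mathbb R}\mathrm{id}\,dr$. For $A\subseteq X$ open or closed let $\int_A f\,d\mu=\int_X f\,d\mu_A$, where $\mu_A$ is the restricted deficient topological measure: if $A$ is open, $\mu_A(U)=\mu(U\cap A)$ for $U$ open and $\mu_A(F)=\inf\{\mu_A(U):F\subseteq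 U,\ U\text{ open}\}$ for $F$ closed; if $A$ is closed, $\mu_A(K)=\mu(A\cap K)$ for $K$ compact, $\mu_A(U)=\sup\{\mu_A(K):K\subseteq U,\ K\text{ compact}\}$ for $U$ open, and $\mu_A(F)=\inf\{\mu_A(U):F\subseteq U,\ U\text{ open}\}$ for $F$ closed. Put $\mu_g(A)=\int_A g\,d\mu$ for $g\in C_0^+(X)$ (nonnegative continuous functions vanishing at infinity), and, for $X$ compact and $g\in C(X)$, $\nu_g(A)=\int_A g\,d\mu$ (so $\nu_g=\mu_g$ if $g\ge 0$). In either case let $n_r$ be the measure on the $\sigma$-algebra $\{g^{-1}(B):B\subseteq\mathbb R\text{ Borel}\}$ of subsets of $X$ with $n_r(g^{-1}(B))=r_{\mu,g}(B)$. **Theorem.** Let $\mu$ be a finite deficient topological measure on $X$ and let $g\in C_0^+(X)$. Then (i) $\mu_g(E)\le\int_E g\,dn_r$ for $E=g^{-1}(A)$, where $A\subseteq\mathbb R$ is open or closed. (ii) $\mu_g(g^{-1}(\{0\}))=\int_{g^{-1}(\{0\})}g\,dn_r=0$, and $\mu_g(E)=\int_E g\,dn_r=0$ for $E=g^{-1}(A)$,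 where $A\subseteq(-\infty,0)$ is open or closed. (iii) If $\mu$ is a topological measure, then $\mu_g(E)=\int_E g\,dn_r$ for $E=g^{-1}(A)$, where $A\subseteq\mathbb R\setminus\{0\}$ is closed (in $\mathbb R$) or $A\subseteq\mathbb R$ is open. (iv) If $X$ is compact and $\mu$ is a topological measure, then for every $g\in C(X)$, $\nu_g(E)=\int_E g\,dn_r$ for $E=g^{-1}(A)$, where $A\subseteq\mathbb R$ is open or closed. (v) If $X$ is compact, then $\mu$ is a topological measure if and only if $\mu_g(E)=\int_E g\,dn_r$ for every nonnegative $g\in C(X)$ and every $E=g^{-1}(C)$ with $C\subseteq\mathbb R$ closed. -/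

import Mathlib

open Set MeasureTheory
open scoped ENNReal ZeroAtInfty

noncomputable section

namespace DTM

theorem comap_le_caratheodory {X : Type*} (g : X → ℝ) (r : Measure ℝ) :
    MeasurableSpace.comap g (borel ℝ) ≤ (OuterMeasure.comap g r.toOuterMeasure).caratheodory := by
  rintro _ ⟨B, hB, rfl⟩ S
  have hB' : MeasurableSet B := by rwa [BorelSpace.measurable_eq (α := ℝ)]
  simp only [OuterMeasure.comap_apply, image_inter_preimage, image_sdiff_preimage]
  exact (measure_inter_add_sdiff (g '' S) hB').symm

/-- The measure on the `σ`-algebra `{g⁻¹(B) : B Borel}` of subsets of `X` pulled back from `r`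
along `g`, `E ↦ r(g(E))`. -/
def pullback {X : Type*} (g : X → ℝ) (r : Measure ℝ) : @Measure X (MeasurableSpace.comap g (borel ℝ)) :=
  @OuterMeasure.toMeasure X (MeasurableSpace.comap g (borel ℝ))
    (OuterMeasure.comap g r.toOuterMeasure) (comap_le_caratheodory g r)

/-- If `r` does not charge the complement of the range of `g`, the pulled back measure is the one
with `n(g⁻¹(B)) = r(B)` for all Borel sets `B`. -/
theorem pullback_preimage {X : Type*} (g : X → ℝ) (r : Measure ℝ) (hr : r (range g)ᶜ = 0) (B : Set ℝ)
    (hB : MeasurableSet B) : pullback g r (g ⁻¹' B) = r B := by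
  have hB' : MeasurableSet[MeasurableSpace.comap g (borel ℝ)] (g ⁻¹' B) :=
    ⟨B, by rwa [BorelSpace.measurable_eq (α := ℝ)] at hB, rfl⟩
  rw [pullback, @toMeasure_apply X (MeasurableSpace.comap g (borel ℝ)) _ _ _ hB', OuterMeasure.comap_apply, image_preimage_eq_inter_range]
  exact measure_inter_conull hr

variable {X : Type*} [TopologicalSpace X]

/-- A deficient topological measure: a `[0, ∞]`-valued set function on the open and the closed
subsets of `X` (the values of `ν` on other sets play no role) which is finitely additive on
compact sets, inner compact regular on open sets, outer regular on closed sets, and not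
identically `∞`. -/
structure IsDeficientTopologicalMeasure (ν : Set X → ℝ≥0∞) : Prop where
  exists_ne_top : ∃ A, (IsOpen A ∨ IsClosed A) ∧ ν A ≠ ∞
  union_compact : ∀ C K, IsCompact C → IsCompact K → Disjoint C K → ν (C ∪ K) = ν C + ν K
  inner_regular : ∀ U, IsOpen U → ν U = ⨆ (K : Set X) (_ : IsCompact K) (_ : K ⊆ U), ν K
  outer_regular : ∀ F, IsClosed F → ν F = ⨅ (U : Set X) (_ : IsOpen U) (_ : F ⊆ U), ν U

/-- A topological measure: additive on disjoint sets `A`, `B` such that each of `A`, `B`, `A ∪ B`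
is compact or open, inner compact regular on open sets, outer regular on closed sets, and not
identically `∞`. -/
structure IsTopologicalMeasure (ν : Set X → ℝ≥0∞) : Prop where
  exists_ne_top : ∃ A, (IsOpen A ∨ IsClosed A) ∧ ν A ≠ ∞
  union : ∀ A B, (IsCompact A ∨ IsOpen A) → (IsCompact B ∨ IsOpen B) →
    (IsCompact (A ∪ B) ∨ IsOpen (A ∪ B)) → Disjoint A B → ν (A ∪ B) = ν A + ν B
  inner_regular : ∀ U, IsOpen U → ν U = ⨆ (K : Set X) (_ : IsCompact K) (_ : K ⊆ U), ν K
  outer_regular : ∀ F, IsClosed F → ν F = ⨅ (U : Set X) (_ : IsOpen U) (_ : F ⊆ U), ν U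

open Classical in
/-- The restriction `μ_V` of `μ` to an open set `V`: `μ_V(U) = μ(U ∩ V)` for `U` open, and
`μ_V(F) = inf {μ_V(U) : F ⊆ U, U open}` for `F` closed. -/
def restrictOpen (μ : Set X → ℝ≥0∞) (V : Set X) : Set X → ℝ≥0∞ := fun B =>
  if IsOpen B then μ (B ∩ V) else ⨅ (U : Set X) (_ : IsOpen U) (_ : B ⊆ U), μ (U ∩ V)

open Classical in
/-- The restriction `μ_F` of `μ` to a closed set `F`: `μ_F(K) = μ(F ∩ K)` for `K` compact,
`μ_F(U) = sup {μ_F(K) : K ⊆ U, K compact}` for `U` open, and on the remaining closed sets the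
value dictated by outer regularity. -/
def restrictClosed (μ : Set X → ℝ≥0∞) (F : Set X) : Set X → ℝ≥0∞ := fun B =>
  if IsCompact B then μ (F ∩ B)
  else if IsOpen B then ⨆ (K : Set X) (_ : IsCompact K) (_ : K ⊆ B), μ (F ∩ K)
  else ⨅ (U : Set X) (_ : IsOpen U) (_ : B ⊆ U),
    ⨆ (K : Set X) (_ : IsCompact K) (_ : K ⊆ U), μ (F ∩ K)

open Classical in
/-- The restriction `μ_A` of `μ` to an open or closed set `A` (the two recipes agree when `A` is
both open and closed and `μ` is a deficient topological measure). -/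
def restrict (μ : Set X → ℝ≥0∞) (A : Set X) : Set X → ℝ≥0∞ :=
  if IsOpen A then restrictOpen μ A else restrictClosed μ A

/-- The distribution function `R₁(t) = μ(f⁻¹((t, ∞)))`. -/
def distr (μ : Set X → ℝ≥0∞) (f : X → ℝ) (t : ℝ) : ℝ :=
  (μ (f ⁻¹' Ioi t)).toReal

open Classical in
/-- The Lebesgue-Stieltjes measure `r` associated with `-R₁`. (For `f` continuous and `μ` a finite
deficient topological measure, `-R₁` is nondecreasing and right-continuous; the value `0` in the
other case is a mere convention.) -/
def stieltjes (μ : Set X → ℝ≥0∞) (f : X → ℝ) : Measure ℝ :=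
  if h : Monotone (fun t => -distr μ f t) then h.stieltjesFunction.measure else 0

/-- The quasi-integral `∫_X f dμ = ∫_ℝ id dr`. -/
def quasiIntegral (μ : Set X → ℝ≥0∞) (f : X → ℝ) : ℝ :=
  ∫ t, t ∂(stieltjes μ f)

/-- The set function `A ↦ ∫_A g dμ = ∫_X g dμ_A` on open and closed sets `A`, written `μ_g`
(for `g ≥ 0` vanishing at infinity) or `ν_g` (for `X` compact and `g` continuous). -/
def integralOver (μ : Set X → ℝ≥0∞) (g : X → ℝ) (A : Set X) : ℝ :=
  quasiIntegral (restrict μ A) g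

/-- The measure `n_r` of `g`, on the `σ`-algebra `{g⁻¹(B) : B Borel}` of subsets of `X`,
`n_r(g⁻¹(B)) = r(B)`, where `r` is the Lebesgue-Stieltjes measure associated with the
distribution function `R₁` of `g` with respect to `μ`. -/
def nMeasure (μ : Set X → ℝ≥0∞) (g : X → ℝ) : @Measure X (MeasurableSpace.comap g (borel ℝ)) :=
  pullback g (stieltjes μ g)

end DTM

end

namespace DTM

section

open Filter Topology

variable {X : Type*} [TopologicalSpace X] {μ φ : Set X → ℝ≥0∞} {g : X → ℝ}

/-! ### Elementary properties of deficient topological measures -/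

namespace IsDeficientTopologicalMeasure

/-! For `E = g⁻¹(A)` everything reduces to comparing two finite measures on the line: the
Lebesgue-Stieltjes measure of `g` under `μ_E`, and `r` restricted to `A`. Their values on `(t, ∞)`
are `μ_E(g > t)` and `r(A ∩ (t, ∞))`.

The key estimate is `μ(g⁻¹(W)) ≤ r(W)` for open `W` (`le_stieltjes_of_isOpen`). A compact subset of
`g⁻¹(W)` splits into finitely many disjoint compact pieces, one over each of finitely many
components of `W`, and superadditivity bounds each piece by the `r`-mass of an interval. Regularity
of `r` carries the estimate to closed sets, hence `μ_E(g > t) ≤ r(A ∩ (t, ∞))`; the layer cake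
formula gives (i), and (ii) follows because `A ∩ (t, ∞)` is empty for `t > 0`.

If `μ` is a topological measure, additivity on `L` and `(a, ∞) \ L` turns the estimates for these
two sets into equalities (`stieltjes_of_isCompact`), and inner regularity of `r` gives equality on
rays. For signed `g` on compact `X` the two measures are then identified outright.

For the converse in (v), a Urysohn function shifted to have values in `[1, 2]` yields `μ(X) ≤ μ(U) +
μ(Uᶜ)` for open `U`. Additivity on complementary pairs implies all the remaining additivity. -/

theorem le_of_isCompact (hμ : IsDeficientTopologicalMeasure μ) {K U : Set X} (hK : IsCompact K)
    (hU : IsOpen U) (h : K ⊆ U) : μ K ≤ μ U := by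
  rw [hμ.inner_regular U hU]
  exact le_iSup₂_of_le K hK (le_iSup_of_le h le_rfl)

theorem le_of_isClosed (hμ : IsDeficientTopologicalMeasure μ) {F U : Set X} (hF : IsClosed F)
    (hU : IsOpen U) (h : F ⊆ U) : μ F ≤ μ U := by
  rw [hμ.outer_regular F hF]
  exact iInf₂_le_of_le U hU (iInf_le_of_le h le_rfl)

theorem mono_isOpen (hμ : IsDeficientTopologicalMeasure μ) {U V : Set X} (hU : IsOpen U)
    (hV : IsOpen V) (h : U ⊆ V) : μ U ≤ μ V := by
  rw [hμ.inner_regular U hU]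
  exact iSup₂_le fun K hK => iSup_le fun hKU => hμ.le_of_isCompact hK hV (hKU.trans h)

theorem mono_isClosed (hμ : IsDeficientTopologicalMeasure μ) {F G : Set X} (hF : IsClosed F)
    (hG : IsClosed G) (h : F ⊆ G) : μ F ≤ μ G := by
  rw [hμ.outer_regular G hG]
  exact le_iInf₂ fun U hU => le_iInf fun hGU => hμ.le_of_isClosed hF hU (h.trans hGU)

theorem exists_lt_isCompact (hμ : IsDeficientTopologicalMeasure μ) {U : Set X} (hU : IsOpen U)
    {c : ℝ≥0∞} (hc : c < μ U) : ∃ K, IsCompact K ∧ K ⊆ U ∧ c < μ K := by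
  rw [hμ.inner_regular U hU] at hc
  simpa only [lt_iSup_iff, exists_prop] using hc

theorem lt_top (hμ : IsDeficientTopologicalMeasure μ) (hfin : μ univ < ∞) {A : Set X}
    (hA : IsOpen A ∨ IsClosed A) : μ A < ∞ := by
  refine lt_of_le_of_lt ?_ hfin
  rcases hA with hA | hA
  · exact hμ.mono_isOpen hA isOpen_univ (subset_univ _)
  · exact hμ.le_of_isClosed hA isOpen_univ (subset_univ _)

theorem empty (hμ : IsDeficientTopologicalMeasure μ) (hfin : μ univ < ∞) : μ ∅ = 0 := by
  have h := hμ.union_compact ∅ ∅ isCompact_empty isCompact_empty (disjoint_empty _)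
  rw [union_empty] at h
  have h0 : μ ∅ ≠ ∞ := (hμ.lt_top hfin (Or.inl isOpen_empty)).ne
  have : μ ∅ + 0 = μ ∅ + μ ∅ := by rw [add_zero]; exact h
  exact ((ENNReal.add_right_inj h0).1 this).symm

/-- Superadditivity. -/
theorem add_le (hμ : IsDeficientTopologicalMeasure μ) {K U V : Set X} (hK : IsCompact K)
    (hU : IsOpen U) (hV : IsOpen V) (hd : Disjoint K U) (hKV : K ⊆ V) (hUV : U ⊆ V) :
    μ K + μ U ≤ μ V := by
  rw [hμ.inner_regular U hU, ENNReal.add_iSup]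
  refine iSup_le fun C => ?_
  by_cases hC : IsCompact C ∧ C ⊆ U
  · simp only [hC.1, hC.2, iSup_pos]
    rw [← hμ.union_compact K C hK hC.1 (hd.mono_right hC.2)]
    exact hμ.le_of_isCompact (hK.union hC.1) hV (union_subset hKV (hC.2.trans hUV))
  · have : (⨆ (_ : IsCompact C) (_ : C ⊆ U), μ C) = 0 := by
      simp only [ENNReal.iSup_eq_zero]
      intro h1 h2
      exact absurd ⟨h1, h2⟩ hC
    rw [this, add_zero]
    exact hμ.le_of_isCompact hK hV hKV

end IsDeficientTopologicalMeasure

/-! ### Finite set functions that are inner continuous on open sets -/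

/-- A finite monotone function of open sets, vanishing at `∅`, whose value at an open set `U` is
approached by its values on the neighbourhoods of the compact subsets of `U`. -/
structure IsInnerContinuous (φ : Set X → ℝ≥0∞) : Prop where
  empty : φ ∅ = 0
  lt_top : φ univ < ∞
  mono : ∀ U V, IsOpen U → IsOpen V → U ⊆ V → φ U ≤ φ V
  inner : ∀ U, IsOpen U → ∀ c < φ U, ∃ K, IsCompact K ∧ K ⊆ U ∧
    ∀ V, IsOpen V → K ⊆ V → c < φ V

theorem IsDeficientTopologicalMeasure.isInnerContinuous (hμ : IsDeficientTopologicalMeasure μ)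
    (hfin : μ univ < ∞) : IsInnerContinuous μ where
  empty := hμ.empty hfin
  lt_top := hfin
  mono _ _ hU hV := hμ.mono_isOpen hU hV
  inner U hU c hc := by
    obtain ⟨K, hK, hKU, hcK⟩ := hμ.exists_lt_isCompact hU hc
    exact ⟨K, hK, hKU, fun V hV hKV => hcK.trans_le (hμ.le_of_isCompact hK hV hKV)⟩

/-- A continuous function attains its minimum on a compact set, so a strict bound leaves a gap. The
gap gives right continuity of the distribution function and lets closed rays replace open ones. -/
theorem exists_lt_subset_preimage_Ici (hg : Continuous g) {K : Set X} (hK : IsCompact K) {t : ℝ}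
    (h : K ⊆ g ⁻¹' Ioi t) : ∃ s, t < s ∧ K ⊆ g ⁻¹' Ici s := by
  rcases K.eq_empty_or_nonempty with rfl | hne
  · exact ⟨t + 1, by linarith, empty_subset _⟩
  · obtain ⟨x, hx, hmin⟩ := hK.exists_isMinOn hne hg.continuousOn
    exact ⟨g x, h hx, fun y hy => hmin hy⟩

namespace IsInnerContinuous

theorem ne_top (hφ : IsInnerContinuous φ) {U : Set X} (hU : IsOpen U) : φ U ≠ ∞ :=
  ((hφ.mono U univ hU isOpen_univ (subset_univ _)).trans_lt hφ.lt_top).ne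

theorem monotone_neg_distr (hφ : IsInnerContinuous φ) (hg : Continuous g) :
    Monotone fun t => -distr φ g t := fun _ _ hst =>
  neg_le_neg (ENNReal.toReal_mono (hφ.ne_top (isOpen_Ioi.preimage hg))
    (hφ.mono _ _ (isOpen_Ioi.preimage hg) (isOpen_Ioi.preimage hg)
      (preimage_mono (Ioi_subset_Ioi hst))))

theorem tendsto_distr (hφ : IsInnerContinuous φ) (hg : Continuous g) (t : ℝ) :
    Tendsto (distr φ g) (𝓝[>] t) (𝓝 (distr φ g t)) := by
  refine (ENNReal.tendsto_toReal (hφ.ne_top (isOpen_Ioi.preimage hg))).comp ?_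
  refine tendsto_order.2 ⟨fun c hc => ?_, fun c hc => ?_⟩
  · obtain ⟨K, hK, hKU, hV⟩ := hφ.inner _ (isOpen_Ioi.preimage hg) c hc
    obtain ⟨s, hts, hs⟩ := exists_lt_subset_preimage_Ici hg hK hKU
    filter_upwards [Ioo_mem_nhdsGT hts] with u hu
    exact hV _ (isOpen_Ioi.preimage hg) fun x hx => hu.2.trans_le (hs hx)
  · filter_upwards [self_mem_nhdsWithin] with u hu
    exact (hφ.mono _ _ (isOpen_Ioi.preimage hg) (isOpen_Ioi.preimage hg)
      (preimage_mono (Ioi_subset_Ioi (le_of_lt hu)))).trans_lt hc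

theorem stieltjesFunction_eq (hφ : IsInnerContinuous φ) (hg : Continuous g) (t : ℝ) :
    (hφ.monotone_neg_distr hg).stieltjesFunction t = -distr φ g t := by
  rw [Monotone.stieltjesFunction_eq]
  exact (hφ.monotone_neg_distr hg).continuousWithinAt_Ioi_iff_rightLim_eq.1
    (hφ.tendsto_distr hg t).neg

theorem stieltjes_Ioi (hφ : IsInnerContinuous φ) (hg : Continuous g) {M : ℝ} (hM : ∀ x, g x ≤ M)
    (t : ℝ) : stieltjes φ g (Ioi t) = φ (g ⁻¹' Ioi t) := by
  have hlim : Tendsto (hφ.monotone_neg_distr hg).stieltjesFunction atTop (𝓝 0) := by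
    refine tendsto_const_nhds.congr' ?_
    filter_upwards [eventually_ge_atTop M] with s hs
    have : g ⁻¹' Ioi s = ∅ := by
      ext x
      simpa using (hM x).trans hs
    rw [hφ.stieltjesFunction_eq hg, distr, this, hφ.empty]
    simp
  rw [stieltjes, dif_pos (hφ.monotone_neg_distr hg), StieltjesFunction.measure_Ioi _ hlim,
    hφ.stieltjesFunction_eq hg, zero_sub, neg_neg, distr,
    ENNReal.ofReal_toReal (hφ.ne_top (isOpen_Ioi.preimage hg))]

theorem stieltjes_Iic (hφ : IsInnerContinuous φ) (hg : Continuous g) {s : ℝ}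
    (hs : ∀ x, s < g x) : stieltjes φ g (Iic s) = 0 := by
  have huniv : ∀ u ≤ s, g ⁻¹' Ioi u = univ := fun u hu =>
    eq_univ_of_forall fun x => hu.trans_lt (hs x)
  have hlim : Tendsto (hφ.monotone_neg_distr hg).stieltjesFunction atBot
      (𝓝 (-(φ univ).toReal)) := by
    refine tendsto_const_nhds.congr' ?_
    filter_upwards [eventually_le_atBot s] with u hu
    rw [hφ.stieltjesFunction_eq hg, distr, huniv u hu]
  rw [stieltjes, dif_pos (hφ.monotone_neg_distr hg), StieltjesFunction.measure_Iic _ hlim,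
    hφ.stieltjesFunction_eq hg, distr, huniv s le_rfl]
  simp

theorem stieltjes_Iio (hφ : IsInnerContinuous φ) (hg : Continuous g) {s : ℝ}
    (hs : ∀ x, s ≤ g x) : stieltjes φ g (Iio s) = 0 := by
  -- There may be an atom at `s` itself; below `s`, the ray up to the midpoint of `y` and `s` is
  -- null.
  refine measure_null_of_locally_null _ fun y hy => ?_
  refine ⟨Iic ((y + s) / 2), mem_nhdsWithin_of_mem_nhds (Iic_mem_nhds ?_),
    hφ.stieltjes_Iic hg fun x => lt_of_lt_of_le ?_ (hs x)⟩ <;> linarith [mem_Iio.1 hy]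

theorem isFiniteMeasure (hφ : IsInnerContinuous φ) (hg : Continuous g) {m M : ℝ}
    (hm : ∀ x, m ≤ g x) (hM : ∀ x, g x ≤ M) : IsFiniteMeasure (stieltjes φ g) := by
  refine ⟨?_⟩
  rw [← Iic_union_Ioi (a := m - 1)]
  refine (measure_union_le _ _).trans_lt ?_
  rw [hφ.stieltjes_Iic hg fun x => by linarith [hm x], hφ.stieltjes_Ioi hg hM, zero_add]
  exact (hφ.ne_top (isOpen_Ioi.preimage hg)).lt_top

end IsInnerContinuous

/-! ### Restricted set functions -/

theorem restrict_of_isOpen {E U : Set X} (hE : IsOpen E) (hU : IsOpen U) :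
    restrict μ E U = μ (U ∩ E) := by
  rw [restrict, if_pos hE, restrictOpen, if_pos hU]

/-- The closed-set formula survives the case distinctions in the definition: for clopen `E` it
agrees with the open recipe by inner regularity, and for compact open `U` the supremum is attained
at `U`. -/
theorem IsDeficientTopologicalMeasure.restrict_of_isClosed [T2Space X]
    (hμ : IsDeficientTopologicalMeasure μ) {E U : Set X} (hE : IsClosed E) (hU : IsOpen U) :
    restrict μ E U = ⨆ (K : Set X) (_ : IsCompact K) (_ : K ⊆ U), μ (E ∩ K) := by
  by_cases hEo : IsOpen E
  · rw [restrict_of_isOpen hEo hU]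
    apply le_antisymm
    · rw [hμ.inner_regular _ (hU.inter hEo)]
      refine iSup₂_le fun K hK => iSup_le fun hKU => ?_
      refine le_iSup₂_of_le K hK (le_iSup_of_le (hKU.trans inter_subset_left) ?_)
      rw [inter_eq_self_of_subset_right (hKU.trans inter_subset_right)]
    · refine iSup₂_le fun K hK => iSup_le fun hKU => ?_
      exact hμ.le_of_isCompact (hK.inter_left hE) (hU.inter hEo)
        (subset_inter (inter_subset_right.trans hKU) inter_subset_left)
  · rw [restrict, if_neg hEo, restrictClosed]
    split_ifs with hUc
    · apply le_antisymm
      · exact le_iSup₂_of_le U hUc (le_iSup_of_le subset_rfl le_rfl)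
      · exact iSup₂_le fun K hK => iSup_le fun hKU =>
          hμ.mono_isClosed (hE.inter hK.isClosed) (hE.inter hUc.isClosed)
            (inter_subset_inter_right _ hKU)
    · rfl

theorem IsDeficientTopologicalMeasure.isInnerContinuous_restrict [T2Space X]
    (hμ : IsDeficientTopologicalMeasure μ) (hfin : μ univ < ∞) {E : Set X}
    (hE : IsOpen E ∨ IsClosed E) : IsInnerContinuous (restrict μ E) := by
  rcases hE with hE | hE
  · refine ⟨?_, ?_, fun U V hU hV hUV => ?_, fun U hU c hc => ?_⟩
    · rw [restrict_of_isOpen hE isOpen_empty, empty_inter, hμ.empty hfin]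
    · rw [restrict_of_isOpen hE isOpen_univ, univ_inter]
      exact hμ.lt_top hfin (Or.inl hE)
    · rw [restrict_of_isOpen hE hU, restrict_of_isOpen hE hV]
      exact hμ.mono_isOpen (hU.inter hE) (hV.inter hE) (inter_subset_inter_left _ hUV)
    · rw [restrict_of_isOpen hE hU] at hc
      obtain ⟨K, hK, hKU, hcK⟩ := hμ.exists_lt_isCompact (hU.inter hE) hc
      refine ⟨K, hK, hKU.trans inter_subset_left, fun V hV hKV => ?_⟩
      rw [restrict_of_isOpen hE hV]
      exact hcK.trans_le (hμ.le_of_isCompact hK (hV.inter hE)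
        (subset_inter hKV (hKU.trans inter_subset_right)))
  · have key : ∀ U, IsOpen U → ∀ K, IsCompact K → K ⊆ U → μ (E ∩ K) ≤ restrict μ E U := by
      intro U hU K hK hKU
      rw [hμ.restrict_of_isClosed hE hU]
      exact le_iSup₂_of_le K hK (le_iSup_of_le hKU le_rfl)
    refine ⟨?_, ?_, fun U V hU hV hUV => ?_, fun U hU c hc => ?_⟩
    · rw [hμ.restrict_of_isClosed hE isOpen_empty, ← nonpos_iff_eq_zero]
      refine iSup₂_le fun K hK => iSup_le fun hKU => ?_
      rw [subset_empty_iff.1 hKU, inter_empty, hμ.empty hfin]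
    · rw [hμ.restrict_of_isClosed hE isOpen_univ]
      refine lt_of_le_of_lt (iSup₂_le fun K hK => iSup_le fun hKU => ?_) hfin
      exact hμ.le_of_isCompact (hK.inter_left hE) isOpen_univ (subset_univ _)
    · rw [hμ.restrict_of_isClosed hE hU]
      exact iSup₂_le fun K hK => iSup_le fun hKU => key V hV K hK (hKU.trans hUV)
    · rw [hμ.restrict_of_isClosed hE hU] at hc
      simp only [lt_iSup_iff, exists_prop] at hc
      obtain ⟨K, hK, hKU, hcK⟩ := hc
      exact ⟨K, hK, hKU, fun V hV hKV => hcK.trans_le (key V hV K hK hKV)⟩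

/-! ### Comparison with the Lebesgue-Stieltjes measure -/

theorem IsDeficientTopologicalMeasure.le_stieltjes_Icc (hμ : IsDeficientTopologicalMeasure μ)
    (hfin : μ univ < ∞) (hg : Continuous g) {m M : ℝ} (hm : ∀ x, m ≤ g x) (hM : ∀ x, g x ≤ M)
    {K : Set X} (hK : IsCompact K) {a b : ℝ} (hKab : K ⊆ g ⁻¹' Icc a b) :
    μ K ≤ stieltjes μ g (Icc a b) := by
  have hφ := hμ.isInnerContinuous hfin
  have := hφ.isFiniteMeasure hg hm hM
  have hIoc : ∀ c < a, μ K ≤ stieltjes μ g (Ioc c b) := by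
    intro c hc
    rcases lt_or_ge b c with hbc | hcb
    · have : K = ∅ := by
        refine eq_empty_of_forall_notMem fun x hx => ?_
        have := hKab hx
        exact absurd (this.1.trans this.2) (by linarith)
      rw [this, hμ.empty hfin]
      exact zero_le
    -- Superadditivity for `K` and the superlevel set above it; subtracting `r(b, ∞)` from `r(c, ∞)`
    -- leaves `r(c, b]`, and then `c` increases to `a`.
    have h1 : μ K + μ (g ⁻¹' Ioi b) ≤ μ (g ⁻¹' Ioi c) := by
      refine hμ.add_le hK (isOpen_Ioi.preimage hg) (isOpen_Ioi.preimage hg) ?_ ?_ ?_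
      · exact disjoint_left.2 fun x hx hx' => (hKab hx).2.not_gt hx'
      · exact fun x hx => hc.trans_le (hKab hx).1
      · exact preimage_mono (Ioi_subset_Ioi hcb)
    rw [← hφ.stieltjes_Ioi hg hM, ← hφ.stieltjes_Ioi hg hM, ← Ioc_union_Ioi_eq_Ioi hcb,
      measure_union (disjoint_left.2 fun x hx hx' => hx.2.not_gt hx') measurableSet_Ioi] at h1
    exact (ENNReal.add_le_add_iff_right (measure_ne_top _ _)).1 h1
  have hu : ∀ n : ℕ, a - 1 / ((n : ℝ) + 1) < a := fun n => by
    have : (0 : ℝ) < 1 / ((n : ℝ) + 1) := Nat.one_div_pos_of_nat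
    linarith
  have hlim : Tendsto (fun n : ℕ => a - 1 / ((n : ℝ) + 1)) atTop (𝓝 a) := by
    simpa using tendsto_one_div_add_atTop_nhds_zero_nat.const_sub a
  have hInter : Icc a b = ⋂ n : ℕ, Ioc (a - 1 / ((n : ℝ) + 1)) b := by
    ext x
    simp only [mem_Icc, mem_iInter, mem_Ioc]
    refine ⟨fun h n => ⟨(hu n).trans_le h.1, h.2⟩, fun h => ⟨?_, (h 0).2⟩⟩
    exact le_of_tendsto' hlim fun n => (h n).1.le
  have hanti : Antitone fun n : ℕ => Ioc (a - 1 / ((n : ℝ) + 1)) b := by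
    intro i j hij
    exact Ioc_subset_Ioc_left (sub_le_sub_left (Nat.one_div_le_one_div hij) _)
  rw [hInter, hanti.measure_iInter (fun n => measurableSet_Ioc.nullMeasurableSet)
    ⟨0, measure_ne_top _ _⟩]
  exact le_iInf fun n => hIoc _ (hu n)

theorem IsDeficientTopologicalMeasure.le_stieltjes_sUnion (hμ : IsDeficientTopologicalMeasure μ)
    (hfin : μ univ < ∞) (hg : Continuous g) {m M : ℝ} (hm : ∀ x, m ≤ g x) (hM : ∀ x, g x ≤ M)
    (T : Finset (Set ℝ)) : (∀ I ∈ T, IsOpen I) → (∀ I ∈ T, I.OrdConnected) →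
    ((T : Set (Set ℝ)).PairwiseDisjoint id) → ∀ K, IsCompact K → K ⊆ g ⁻¹' ⋃₀ (T : Set (Set ℝ)) →
    μ K ≤ stieltjes μ g (⋃₀ (T : Set (Set ℝ))) := by
  classical
  induction T using Finset.induction_on with
  | empty =>
    intro _ _ _ K _ hKT
    have : K = ∅ := by simpa using hKT
    rw [this, hμ.empty hfin]
    exact zero_le
  | insert I T hIT ih =>
    intro ho hc hd K hK hKT
    have hIo := ho I (Finset.mem_insert_self _ _)
    have hTo : ∀ J ∈ T, IsOpen J := fun J hJ => ho J (Finset.mem_insert_of_mem hJ)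
    have hTo' : IsOpen (⋃₀ (T : Set (Set ℝ))) := isOpen_sUnion hTo
    have hdIT : Disjoint I (⋃₀ (T : Set (Set ℝ))) := by
      refine disjoint_sUnion_right.2 fun J hJ => ?_
      refine hd (by simp) (by simpa using Or.inr hJ) ?_
      rintro rfl
      exact hIT hJ
    rw [Finset.coe_insert, sUnion_insert] at hKT ⊢
    -- Removing the open preimage of the other intervals keeps the piece over `I` compact.
    have hK1 : K \ g ⁻¹' (⋃₀ (T : Set (Set ℝ))) ⊆ g ⁻¹' I := fun x hx =>
      (hKT hx.1).resolve_right hx.2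
    have hK2 : K \ g ⁻¹' I ⊆ g ⁻¹' (⋃₀ (T : Set (Set ℝ))) := fun x hx =>
      (hKT hx.1).resolve_left hx.2
    have hc1 := hK.diff (hTo'.preimage hg)
    have hc2 := hK.diff (hIo.preimage hg)
    have hKeq : K = (K \ g ⁻¹' (⋃₀ (T : Set (Set ℝ)))) ∪ (K \ g ⁻¹' I) := by
      ext x
      refine ⟨fun hx => ?_, fun hx => hx.elim And.left And.left⟩
      rcases hKT hx with h | h
      · exact Or.inl ⟨hx, fun h' => disjoint_left.1 hdIT h h'⟩
      · exact Or.inr ⟨hx, fun h' => disjoint_left.1 hdIT h' h⟩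
    rw [hKeq, hμ.union_compact _ _ hc1 hc2
      (disjoint_left.2 fun x hx hx' => hx'.2 (hK1 hx)),
      measure_union hdIT hTo'.measurableSet]
    refine add_le_add ?_ (ih hTo (fun J hJ => hc J (Finset.mem_insert_of_mem hJ))
      (hd.subset (by simp)) _ hc2 hK2)
    rcases (K \ g ⁻¹' (⋃₀ (T : Set (Set ℝ)))).eq_empty_or_nonempty with he | hne
    · rw [he, hμ.empty hfin]
      exact zero_le
    -- The extreme values of `g` on the piece are attained in `I`, so the interval between them lies
    -- in `I`.
    obtain ⟨x, hx, hxmin⟩ := hc1.exists_isMinOn hne hg.continuousOn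
    obtain ⟨y, hy, hymax⟩ := hc1.exists_isMaxOn hne hg.continuousOn
    refine (hμ.le_stieltjes_Icc hfin hg hm hM hc1 (a := g x) (b := g y)
      fun z hz => ⟨hxmin hz, hymax hz⟩).trans (measure_mono ?_)
    exact (hc I (Finset.mem_insert_self _ _)).out (hK1 hx) (hK1 hy)

theorem IsDeficientTopologicalMeasure.le_stieltjes_of_isOpen (hμ : IsDeficientTopologicalMeasure μ)
    (hfin : μ univ < ∞) (hg : Continuous g) {m M : ℝ} (hm : ∀ x, m ≤ g x) (hM : ∀ x, g x ≤ M)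
    {W : Set ℝ} (hW : IsOpen W) : μ (g ⁻¹' W) ≤ stieltjes μ g W := by
  classical
  rw [hμ.inner_regular _ (hW.preimage hg)]
  refine iSup₂_le fun K hK => iSup_le fun hKW => ?_
  have hsub : ∀ x ∈ K, g x ∈ connectedComponentIn W (g x) := fun x hx =>
    mem_connectedComponentIn (hKW hx)
  obtain ⟨t, ht⟩ := hK.elim_nhds_subcover' (fun x _ => g ⁻¹' connectedComponentIn W (g x))
    fun x hx => (hW.connectedComponentIn.preimage hg).mem_nhds (hsub x hx)
  -- Taking the image identifies repeated components, so distinct members of `T` are disjoint.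
  let T : Finset (Set ℝ) := t.image fun x : K => connectedComponentIn W (g x)
  have hT : ∀ I ∈ T, ∃ x : X, I = connectedComponentIn W (g x) := by
    intro I hI
    obtain ⟨x, -, rfl⟩ := Finset.mem_image.1 hI
    exact ⟨x, rfl⟩
  refine (hμ.le_stieltjes_sUnion hfin hg hm hM T ?_ ?_ ?_ K hK ?_).trans (measure_mono ?_)
  · intro I hI
    obtain ⟨x, rfl⟩ := hT I hI
    exact hW.connectedComponentIn
  · intro I hI
    obtain ⟨x, rfl⟩ := hT I hI
    exact isPreconnected_connectedComponentIn.ordConnected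
  · intro I hI J hJ hne
    obtain ⟨x, rfl⟩ := hT I hI
    obtain ⟨y, rfl⟩ := hT J hJ
    rw [Function.onFun, id, id, disjoint_left]
    intro z hz hz'
    exact hne ((connectedComponentIn_eq hz).trans (connectedComponentIn_eq hz').symm)
  · intro x hx
    obtain ⟨y, hy, hxy⟩ := mem_iUnion₂.1 (ht hx)
    exact ⟨_, Finset.mem_coe.2 (Finset.mem_image_of_mem _ hy), hxy⟩
  · refine sUnion_subset fun I hI => ?_
    obtain ⟨x, rfl⟩ := hT I hI
    exact connectedComponentIn_subset _ _

theorem IsDeficientTopologicalMeasure.le_stieltjes_of_isClosed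
    (hμ : IsDeficientTopologicalMeasure μ)
    (hfin : μ univ < ∞) (hg : Continuous g) {m M : ℝ} (hm : ∀ x, m ≤ g x) (hM : ∀ x, g x ≤ M)
    {L : Set ℝ} (hL : IsClosed L) : μ (g ⁻¹' L) ≤ stieltjes μ g L := by
  have := (hμ.isInnerContinuous hfin).isFiniteMeasure hg hm hM
  refine le_of_forall_gt fun c hc => ?_
  obtain ⟨W, hLW, hW, hWc⟩ := L.exists_isOpen_lt_of_lt c hc
  exact ((hμ.le_of_isClosed (hL.preimage hg) (hW.preimage hg) (preimage_mono hLW)).trans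
    (hμ.le_stieltjes_of_isOpen hfin hg hm hM hW)).trans_lt hWc

theorem IsDeficientTopologicalMeasure.restrict_le_stieltjes [T2Space X]
    (hμ : IsDeficientTopologicalMeasure μ) (hfin : μ univ < ∞) (hg : Continuous g) {m M : ℝ}
    (hm : ∀ x, m ≤ g x) (hM : ∀ x, g x ≤ M) {A : Set ℝ} (hA : IsOpen A ∨ IsClosed A) (t : ℝ) :
    restrict μ (g ⁻¹' A) (g ⁻¹' Ioi t) ≤ stieltjes μ g (A ∩ Ioi t) := by
  rcases hA with hA | hA
  · rw [restrict_of_isOpen (hA.preimage hg) (isOpen_Ioi.preimage hg), ← preimage_inter, inter_comm]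
    exact hμ.le_stieltjes_of_isOpen hfin hg hm hM (hA.inter isOpen_Ioi)
  · rw [hμ.restrict_of_isClosed (hA.preimage hg) (isOpen_Ioi.preimage hg)]
    refine iSup₂_le fun K hK => iSup_le fun hKt => ?_
    obtain ⟨s, hts, hs⟩ := exists_lt_subset_preimage_Ici hg hK hKt
    calc μ (g ⁻¹' A ∩ K) ≤ μ (g ⁻¹' (A ∩ Ici s)) :=
          hμ.mono_isClosed ((hA.preimage hg).inter hK.isClosed)
            ((hA.inter isClosed_Ici).preimage hg) (inter_subset_inter_right _ hs)
      _ ≤ stieltjes μ g (A ∩ Ici s) :=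
          hμ.le_stieltjes_of_isClosed hfin hg hm hM (hA.inter isClosed_Ici)
      _ ≤ stieltjes μ g (A ∩ Ioi t) :=
          measure_mono (inter_subset_inter_right _ (Ici_subset_Ioi.2 hts))

/-- For a topological measure, the Lebesgue-Stieltjes measure of a compact set `L` is the value of
`μ` at the preimage of `L`. -/
theorem IsTopologicalMeasure.stieltjes_of_isCompact (hτ : IsTopologicalMeasure μ)
    (hμ : IsDeficientTopologicalMeasure μ) (hfin : μ univ < ∞) (hg : Continuous g) {m M : ℝ}
    (hm : ∀ x, m ≤ g x) (hM : ∀ x, g x ≤ M) {a : ℝ} (ha : ∀ s > a, IsCompact (g ⁻¹' Ici s))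
    {L : Set ℝ} (hL : IsCompact L) (hLa : L ⊆ Ioi a) : stieltjes μ g L = μ (g ⁻¹' L) := by
  have hφ := hμ.isInnerContinuous hfin
  have := hφ.isFiniteMeasure hg hm hM
  have hLc : IsCompact (g ⁻¹' L) := by
    obtain ⟨s, has, hs⟩ := exists_lt_subset_preimage_Ici continuous_id hL hLa
    exact (ha s has).of_isClosed_subset (hL.isClosed.preimage hg) (preimage_mono hs)
  have hd : IsOpen (Ioi a \ L) := isOpen_Ioi.sdiff hL.isClosed
  -- Both sums equal `μ(g > a)`. Each term on the left is at most its counterpart on the right, so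
  -- finiteness forces termwise equality.
  have h1 : μ (g ⁻¹' L) + μ (g ⁻¹' (Ioi a \ L)) = stieltjes μ g L + stieltjes μ g (Ioi a \ L) := by
    have hu : g ⁻¹' L ∪ g ⁻¹' (Ioi a \ L) = g ⁻¹' Ioi a := by
      rw [← preimage_union, union_sdiff_cancel hLa]
    rw [← hτ.union _ _ (Or.inl hLc) (Or.inr (hd.preimage hg))
      (Or.inr (by rw [hu]; exact isOpen_Ioi.preimage hg)) (disjoint_sdiff_right.preimage g), hu,
      ← hφ.stieltjes_Ioi hg hM, ← measure_union disjoint_sdiff_right hd.measurableSet,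
      union_sdiff_cancel hLa]
  refine le_antisymm ?_ (hμ.le_stieltjes_of_isClosed hfin hg hm hM hL.isClosed)
  have h2 := hμ.le_stieltjes_of_isOpen hfin hg hm hM hd
  have h3 : stieltjes μ g L + stieltjes μ g (Ioi a \ L) ≤
      μ (g ⁻¹' L) + stieltjes μ g (Ioi a \ L) := h1 ▸ add_le_add_right h2 _
  exact (ENNReal.add_le_add_iff_right (measure_ne_top _ _)).1 h3

/-- Inner regularity of `r` reduces the missing inequality to compact `L ⊆ A ∩ (t, ∞)`. The level
`a` marks where superlevel sets become compact: `0` for functions vanishing at infinity, anything on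
a compact space. -/
theorem IsTopologicalMeasure.restrict_eq_stieltjes [T2Space X] (hτ : IsTopologicalMeasure μ)
    (hμ : IsDeficientTopologicalMeasure μ) (hfin : μ univ < ∞) (hg : Continuous g) {m M : ℝ}
    (hm : ∀ x, m ≤ g x) (hM : ∀ x, g x ≤ M) {a : ℝ} (ha : ∀ s > a, IsCompact (g ⁻¹' Ici s))
    {A : Set ℝ} (hA : IsOpen A ∨ IsClosed A) {t : ℝ} (hat : a ≤ t) :
    restrict μ (g ⁻¹' A) (g ⁻¹' Ioi t) = stieltjes μ g (A ∩ Ioi t) := by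
  have := (hμ.isInnerContinuous hfin).isFiniteMeasure hg hm hM
  refine le_antisymm (hμ.restrict_le_stieltjes hfin hg hm hM hA t) (le_of_forall_lt fun c hc => ?_)
  have hAm : MeasurableSet A := hA.elim IsOpen.measurableSet IsClosed.measurableSet
  obtain ⟨L, hLA, hL, hcL⟩ := (hAm.inter measurableSet_Ioi).exists_lt_isCompact_of_ne_top
    (measure_ne_top _ _) hc
  have hLt : L ⊆ Ioi t := hLA.trans inter_subset_right
  rw [hτ.stieltjes_of_isCompact hμ hfin hg hm hM ha hL (hLt.trans (Ioi_subset_Ioi hat))] at hcL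
  refine hcL.trans_le ?_
  rcases hA with hA | hA
  · rw [restrict_of_isOpen (hA.preimage hg) (isOpen_Ioi.preimage hg), ← preimage_inter, inter_comm]
    exact hμ.le_of_isClosed (hL.isClosed.preimage hg) ((hA.inter isOpen_Ioi).preimage hg)
      (preimage_mono hLA)
  · rw [hμ.restrict_of_isClosed (hA.preimage hg) (isOpen_Ioi.preimage hg)]
    have hLc : IsCompact (g ⁻¹' L) := by
      obtain ⟨s, hts, hs⟩ := exists_lt_subset_preimage_Ici continuous_id hL hLt
      exact (ha s (hat.trans_lt hts)).of_isClosed_subset (hL.isClosed.preimage hg)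
        (preimage_mono hs)
    refine le_iSup₂_of_le _ hLc (le_iSup_of_le (preimage_mono hLt) ?_)
    rw [← preimage_inter, inter_eq_self_of_subset_right (hLA.trans inter_subset_left)]

end

end DTM

namespace DTM

section

open Filter Topology

variable {X : Type*} [TopologicalSpace X] {μ φ : Set X → ℝ≥0∞} {g : X → ℝ}

/-! ### Quasi-integrals and integrals with respect to the pulled back measure -/

/-- The layer cake formula; it turns inequalities between masses of rays into inequalities between
integrals. -/
theorem integral_id_eq_toReal_lintegral {ρ : Measure ℝ} (hρ : ρ (Iio 0) = 0) :
    ∫ t, t ∂ρ = (∫⁻ t in Ioi 0, ρ (Ioi t)).toReal := by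
  have h0 : 0 ≤ᵐ[ρ] fun t : ℝ => t := by
    filter_upwards [measure_eq_zero_iff_ae_notMem.1 hρ] with t ht
    simpa using ht
  rw [integral_eq_lintegral_of_nonneg_ae h0 aestronglyMeasurable_id,
    lintegral_eq_lintegral_meas_lt ρ h0 aemeasurable_id]
  rfl

theorem IsInnerContinuous.quasiIntegral_eq (hφ : IsInnerContinuous φ) (hg : Continuous g) {M : ℝ}
    (h0 : ∀ x, 0 ≤ g x) (hM : ∀ x, g x ≤ M) :
    quasiIntegral φ g = (∫⁻ t in Ioi 0, φ (g ⁻¹' Ioi t)).toReal := by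
  rw [quasiIntegral, integral_id_eq_toReal_lintegral (hφ.stieltjes_Iio hg h0)]
  simp only [hφ.stieltjes_Ioi hg hM]

theorem IsInnerContinuous.setIntegral_stieltjes (hφ : IsInnerContinuous φ) (hg : Continuous g)
    (h0 : ∀ x, 0 ≤ g x) {A : Set ℝ} (hA : MeasurableSet A) :
    ∫ t in A, t ∂(stieltjes φ g) = (∫⁻ t in Ioi 0, stieltjes φ g (A ∩ Ioi t)).toReal := by
  rw [integral_id_eq_toReal_lintegral
    (nonpos_iff_eq_zero.1 ((Measure.restrict_apply_le _ _).trans_eq (hφ.stieltjes_Iio hg h0)))]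
  simp only [Measure.restrict_apply' hA, inter_comm A]

/-- By connectedness the range is an interval, and it contains its maximum, so only points above the
maximum or below all values are missed. This makes `n_r(g⁻¹(B)) = r(B)` legitimate. -/
theorem IsInnerContinuous.stieltjes_compl_range [ConnectedSpace X] (hφ : IsInnerContinuous φ)
    (hg : Continuous g) {x₀ : X} (hx₀ : ∀ x, g x ≤ g x₀) : stieltjes φ g (range g)ᶜ = 0 := by
  have hsub : (range g)ᶜ ⊆ {y | ∀ x, y < g x} ∪ Ioi (g x₀) := by
    intro y hy
    by_contra h
    simp only [mem_union, mem_ofPred_eq, mem_Ioi, not_or, not_forall, not_lt] at h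
    obtain ⟨⟨x, hx⟩, hy'⟩ := h
    exact hy ((isPreconnected_range hg).ordConnected.out ⟨x, rfl⟩ ⟨x₀, rfl⟩ ⟨hx, hy'⟩)
  refine measure_mono_null hsub (measure_union_null ?_ ?_)
  · refine measure_null_of_locally_null _ fun y hy => ?_
    -- The infimum of `g` need not be attained. If `y` equals it, `y` is the largest strict lower
    -- bound, and `Iic y` is a neighbourhood of `y` relative to the set of strict lower bounds.
    by_cases hmax : ∃ z, y < z ∧ ∀ x, z < g x
    · obtain ⟨z, hyz, hz⟩ := hmax
      exact ⟨Iic z, mem_nhdsWithin_of_mem_nhds (Iic_mem_nhds hyz), hφ.stieltjes_Iic hg hz⟩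
    · push Not at hmax
      refine ⟨Iic y, ?_, hφ.stieltjes_Iic hg hy⟩
      filter_upwards [self_mem_nhdsWithin] with z hz
      by_contra hyz
      obtain ⟨x, hx⟩ := hmax z (not_le.1 hyz)
      exact (hz x).not_ge hx
  · rw [hφ.stieltjes_Ioi hg hx₀]
    have : g ⁻¹' Ioi (g x₀) = ∅ := by
      ext x
      simpa using hx₀ x
    rw [this, hφ.empty]

theorem setIntegral_pullback {Y : Type*} (g : Y → ℝ) {r : Measure ℝ} (hr : r (range g)ᶜ = 0) {A : Set ℝ}
    (hA : MeasurableSet A) : ∫ x in g ⁻¹' A, g x ∂(pullback g r) = ∫ t in A, t ∂r := by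
  let m : MeasurableSpace Y := MeasurableSpace.comap g (borel ℝ)
  have hgm : Measurable g := by
    rw [BorelSpace.measurable_eq (α := ℝ)]
    exact comap_measurable g
  have hmap : (pullback g r).map g = r := by
    ext B hB
    rw [Measure.map_apply hgm hB, pullback_preimage g r hr B hB]
  rw [← setIntegral_map (f := fun t : ℝ => t) hA aestronglyMeasurable_id hgm.aemeasurable, hmap]

theorem IsDeficientTopologicalMeasure.setIntegral_nMeasure [ConnectedSpace X]
    (hμ : IsDeficientTopologicalMeasure μ) (hfin : μ univ < ∞) (hg : Continuous g) {x₀ : X}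
    (hx₀ : ∀ x, g x ≤ g x₀) {A : Set ℝ} (hA : IsOpen A ∨ IsClosed A) :
    ∫ x in g ⁻¹' A, g x ∂(nMeasure μ g) = ∫ t in A, t ∂(stieltjes μ g) :=
  setIntegral_pullback g ((hμ.isInnerContinuous hfin).stieltjes_compl_range hg hx₀)
    (hA.elim IsOpen.measurableSet IsClosed.measurableSet)

theorem isOpen_or_isClosed_preimage (hg : Continuous g) {A : Set ℝ} (hA : IsOpen A ∨ IsClosed A) :
    IsOpen (g ⁻¹' A) ∨ IsClosed (g ⁻¹' A) :=
  hA.imp (fun h => h.preimage hg) fun h => h.preimage hg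

theorem IsDeficientTopologicalMeasure.integralOver_le [T2Space X] [ConnectedSpace X]
    (hμ : IsDeficientTopologicalMeasure μ) (hfin : μ univ < ∞) (hg : Continuous g)
    (h0 : ∀ x, 0 ≤ g x) {x₀ : X} (hx₀ : ∀ x, g x ≤ g x₀) {A : Set ℝ}
    (hA : IsOpen A ∨ IsClosed A) :
    integralOver μ g (g ⁻¹' A) ≤ ∫ x in g ⁻¹' A, g x ∂(nMeasure μ g) := by
  have hφ := hμ.isInnerContinuous hfin
  have hAm : MeasurableSet A := hA.elim IsOpen.measurableSet IsClosed.measurableSet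
  have := hφ.isFiniteMeasure hg h0 hx₀
  rw [hμ.setIntegral_nMeasure hfin hg hx₀ hA, hφ.setIntegral_stieltjes hg h0 hAm, integralOver,
    (hμ.isInnerContinuous_restrict hfin (isOpen_or_isClosed_preimage hg hA)).quasiIntegral_eq
      hg h0 hx₀]
  refine ENNReal.toReal_mono (ne_of_lt ?_)
    (lintegral_mono fun t => hμ.restrict_le_stieltjes hfin hg h0 hx₀ hA t)
  -- Passing to real values needs a finite upper integral: the integrand is bounded and vanishes
  -- from the maximum of `g` on.
  calc ∫⁻ t in Ioi 0, stieltjes μ g (A ∩ Ioi t)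
      ≤ ∫⁻ t in Ioi 0, (Iio (g x₀)).indicator (fun _ => stieltjes μ g univ) t := by
        refine lintegral_mono fun t => ?_
        by_cases ht : t < g x₀
        · rw [indicator_of_mem (mem_Iio.2 ht)]
          exact measure_mono (subset_univ _)
        · rw [indicator_of_notMem (by simpa using ht), nonpos_iff_eq_zero]
          refine measure_mono_null inter_subset_right ?_
          rw [hφ.stieltjes_Ioi hg hx₀]
          have : g ⁻¹' Ioi t = ∅ := by
            ext x
            simpa using (hx₀ x).trans (not_lt.1 ht)
          rw [this, hφ.empty]
    _ = stieltjes μ g univ * volume (Iio (g x₀) ∩ Ioi 0) := by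
        rw [lintegral_indicator_const measurableSet_Iio, Measure.restrict_apply measurableSet_Iio]
    _ < ∞ := by
        rw [inter_comm, Ioi_inter_Iio, Real.volume_Ioo]
        exact ENNReal.mul_lt_top (measure_lt_top _ _) ENNReal.ofReal_lt_top

theorem IsDeficientTopologicalMeasure.integralOver_nonneg [T2Space X]
    (hμ : IsDeficientTopologicalMeasure μ) (hfin : μ univ < ∞) (hg : Continuous g)
    (h0 : ∀ x, 0 ≤ g x) {M : ℝ} (hM : ∀ x, g x ≤ M) {E : Set X} (hE : IsOpen E ∨ IsClosed E) :
    0 ≤ integralOver μ g E := by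
  rw [integralOver, (hμ.isInnerContinuous_restrict hfin hE).quasiIntegral_eq hg h0 hM]
  exact ENNReal.toReal_nonneg

theorem IsDeficientTopologicalMeasure.integral_eq_zero_of_subset_Iic [T2Space X] [ConnectedSpace X]
    (hμ : IsDeficientTopologicalMeasure μ) (hfin : μ univ < ∞) (hg : Continuous g)
    (h0 : ∀ x, 0 ≤ g x) {x₀ : X} (hx₀ : ∀ x, g x ≤ g x₀) {A : Set ℝ}
    (hA : IsOpen A ∨ IsClosed A) (hA0 : A ⊆ Iic 0) :
    integralOver μ g (g ⁻¹' A) = 0 ∧ ∫ x in g ⁻¹' A, g x ∂(nMeasure μ g) = 0 := by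
  have hAm : MeasurableSet A := hA.elim IsOpen.measurableSet IsClosed.measurableSet
  have h : ∫ x in g ⁻¹' A, g x ∂(nMeasure μ g) = 0 := by
    rw [hμ.setIntegral_nMeasure hfin hg hx₀ hA,
      (hμ.isInnerContinuous hfin).setIntegral_stieltjes hg h0 hAm,
      setLIntegral_congr_fun (g := fun _ => 0) measurableSet_Ioi, lintegral_zero,
      ENNReal.toReal_zero]
    intro t ht
    have : A ∩ Ioi t = ∅ := by
      refine eq_empty_of_forall_notMem fun s hs => ?_
      have h1 : s ≤ 0 := hA0 hs.1
      have h2 : t < s := hs.2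
      have h3 : 0 < t := ht
      linarith
    simp only [this, measure_empty]
  exact ⟨le_antisymm (h ▸ hμ.integralOver_le hfin hg h0 hx₀ hA)
    (hμ.integralOver_nonneg hfin hg h0 hx₀ (isOpen_or_isClosed_preimage hg hA)), h⟩

theorem IsTopologicalMeasure.integralOver_eq_of_nonneg [T2Space X] [ConnectedSpace X]
    (hτ : IsTopologicalMeasure μ) (hμ : IsDeficientTopologicalMeasure μ) (hfin : μ univ < ∞)
    (hg : Continuous g) (h0 : ∀ x, 0 ≤ g x) {x₀ : X} (hx₀ : ∀ x, g x ≤ g x₀)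
    (hc : ∀ s > 0, IsCompact (g ⁻¹' Ici s)) {A : Set ℝ} (hA : IsOpen A ∨ IsClosed A) :
    integralOver μ g (g ⁻¹' A) = ∫ x in g ⁻¹' A, g x ∂(nMeasure μ g) := by
  have hAm : MeasurableSet A := hA.elim IsOpen.measurableSet IsClosed.measurableSet
  rw [hμ.setIntegral_nMeasure hfin hg hx₀ hA,
    (hμ.isInnerContinuous hfin).setIntegral_stieltjes hg h0 hAm, integralOver,
    (hμ.isInnerContinuous_restrict hfin (isOpen_or_isClosed_preimage hg hA)).quasiIntegral_eq
      hg h0 hx₀]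
  congr 1
  exact setLIntegral_congr_fun measurableSet_Ioi fun t ht =>
    hτ.restrict_eq_stieltjes hμ hfin hg h0 hx₀ hc hA (le_of_lt ht)

theorem IsTopologicalMeasure.integralOver_eq_of_compactSpace [T2Space X] [ConnectedSpace X]
    [CompactSpace X] (hτ : IsTopologicalMeasure μ) (hμ : IsDeficientTopologicalMeasure μ)
    (hfin : μ univ < ∞) (hg : Continuous g) {A : Set ℝ} (hA : IsOpen A ∨ IsClosed A) :
    integralOver μ g (g ⁻¹' A) = ∫ x in g ⁻¹' A, g x ∂(nMeasure μ g) := by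
  obtain ⟨x₀, -, hx₀⟩ := isCompact_univ.exists_isMaxOn (univ_nonempty (α := X)) hg.continuousOn
  obtain ⟨x₁, -, hx₁⟩ := isCompact_univ.exists_isMinOn (univ_nonempty (α := X)) hg.continuousOn
  replace hx₀ : ∀ x, g x ≤ g x₀ := fun x => hx₀ (mem_univ x)
  replace hx₁ : ∀ x, g x₁ ≤ g x := fun x => hx₁ (mem_univ x)
  have hφ := hμ.isInnerContinuous hfin
  have hφE := hμ.isInnerContinuous_restrict hfin (isOpen_or_isClosed_preimage hg hA)
  have := hφ.isFiniteMeasure hg hx₁ hx₀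
  have := hφE.isFiniteMeasure hg hx₁ hx₀
  have hIoi : ∀ t, stieltjes (restrict μ (g ⁻¹' A)) g (Ioi t) =
      (stieltjes μ g).restrict A (Ioi t) := by
    intro t
    rw [hφE.stieltjes_Ioi hg hx₀, Measure.restrict_apply measurableSet_Ioi, inter_comm]
    exact hτ.restrict_eq_stieltjes hμ hfin hg hx₁ hx₀ (a := t)
      (fun s _ => (isClosed_Ici.preimage hg).isCompact) hA le_rfl
  have hIic : stieltjes (restrict μ (g ⁻¹' A)) g (Iic (g x₁ - 1)) =
      (stieltjes μ g).restrict A (Iic (g x₁ - 1)) := by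
    have hlt : ∀ x, g x₁ - 1 < g x := fun x => by linarith [hx₁ x]
    rw [hφE.stieltjes_Iic hg hlt]
    exact (nonpos_iff_eq_zero.1 ((Measure.restrict_apply_le _ _).trans_eq
      (hφ.stieltjes_Iic hg hlt))).symm
  -- With `g` signed, the layer cake formula above does not apply; finite measures agreeing on rays
  -- and in total mass coincide.
  have heq : stieltjes (restrict μ (g ⁻¹' A)) g = (stieltjes μ g).restrict A := by
    refine Measure.ext_of_Ioc_finite _ _ ?_ fun a b hab => ?_
    · rw [← Iic_union_Ioi (a := g x₁ - 1), measure_union (Iic_disjoint_Ioi le_rfl) measurableSet_Ioi,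
        measure_union (Iic_disjoint_Ioi le_rfl) measurableSet_Ioi, hIoi, hIic]
    · rw [← Ioi_sdiff_Ioi, measure_sdiff (Ioi_subset_Ioi hab.le)
        measurableSet_Ioi.nullMeasurableSet (measure_ne_top _ _),
        measure_sdiff (Ioi_subset_Ioi hab.le)
        measurableSet_Ioi.nullMeasurableSet (measure_ne_top _ _), hIoi, hIoi]
  rw [hμ.setIntegral_nMeasure hfin hg hx₀ hA, integralOver, quasiIntegral, heq]

/-! ### A criterion for a deficient topological measure to be a topological measure -/

theorem IsDeficientTopologicalMeasure.union_isOpen (hμ : IsDeficientTopologicalMeasure μ)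
    {U V : Set X} (hU : IsOpen U) (hV : IsOpen V) (hd : Disjoint U V) :
    μ (U ∪ V) = μ U + μ V := by
  apply le_antisymm
  · rw [hμ.inner_regular _ (hU.union hV)]
    refine iSup₂_le fun K hK => iSup_le fun hKUV => ?_
    have h1 : K \ V ⊆ U := fun x hx => (hKUV hx.1).resolve_right hx.2
    have h2 : K \ U ⊆ V := fun x hx => (hKUV hx.1).resolve_left hx.2
    have hKeq : K = (K \ V) ∪ (K \ U) := by
      ext x
      refine ⟨fun hx => ?_, fun hx => hx.elim And.left And.left⟩
      by_cases hxV : x ∈ V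
      · exact Or.inr ⟨hx, fun hxU => disjoint_left.1 hd hxU hxV⟩
      · exact Or.inl ⟨hx, hxV⟩
    rw [hKeq, hμ.union_compact _ _ (hK.diff hV) (hK.diff hU)
      (disjoint_left.2 fun x hx hx' => hx'.2 (h1 hx))]
    exact add_le_add (hμ.le_of_isCompact (hK.diff hV) hU h1)
      (hμ.le_of_isCompact (hK.diff hU) hV h2)
  · nth_rw 1 [hμ.inner_regular U hU]
    rw [ENNReal.iSup_add]
    refine iSup_le fun C => ?_
    by_cases hC : IsCompact C ∧ C ⊆ U
    · simp only [hC.1, hC.2, iSup_pos]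
      exact hμ.add_le hC.1 hV (hU.union hV) (hd.mono_left hC.2)
        (hC.2.trans subset_union_left) subset_union_right
    · have : (⨆ (_ : IsCompact C) (_ : C ⊆ U), μ C) = 0 := by
        simp only [ENNReal.iSup_eq_zero]
        intro h1 h2
        exact absurd ⟨h1, h2⟩ hC
      rw [this, zero_add]
      exact hμ.mono_isOpen hV (hU.union hV) subset_union_right

/-- Compact pairs and open pairs are additive for every deficient topological measure. A mixed pair
is reduced to one of these by passing to complements. -/
theorem IsDeficientTopologicalMeasure.isTopologicalMeasure [T2Space X] [CompactSpace X]
    (hμ : IsDeficientTopologicalMeasure μ) (hfin : μ univ < ∞)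
    (h : ∀ U, IsOpen U → μ univ ≤ μ U + μ Uᶜ) : IsTopologicalMeasure μ := by
  have hcompl : ∀ U, IsOpen U → μ U + μ Uᶜ = μ univ := fun U hU => by
    refine le_antisymm ?_ (h U hU)
    rw [add_comm]
    exact hμ.add_le hU.isClosed_compl.isCompact hU isOpen_univ disjoint_compl_left
      (subset_univ _) (subset_univ _)
  have hmixed : ∀ F U, IsClosed F → IsOpen U → (IsClosed (F ∪ U) ∨ IsOpen (F ∪ U)) →
      Disjoint F U → μ (F ∪ U) = μ F + μ U := by
    intro F U hF hU hFU hd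
    have hF1 := hcompl Fᶜ hF.isOpen_compl
    have hU1 := hcompl U hU
    rw [compl_compl] at hF1
    rcases hFU with hFU | hFU
    -- Here `Fᶜ` is the disjoint union of the open sets `U` and `(F ∪ U)ᶜ`; in the other case `Uᶜ`
    -- is that of the compact sets `F` and `(F ∪ U)ᶜ`.
    · have h1 := hcompl (F ∪ U)ᶜ hFU.isOpen_compl
      have h2 := hμ.union_isOpen hU hFU.isOpen_compl
        (disjoint_compl_right.mono_left subset_union_right)
      have h3 : U ∪ (F ∪ U)ᶜ = Fᶜ := by
        ext x
        have : x ∈ F → x ∉ U := fun h => disjoint_left.1 hd h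
        simp only [mem_union, mem_compl_iff]
        tauto
      rw [compl_compl] at h1
      rw [h3] at h2
      have hne := (hμ.lt_top hfin (Or.inl hFU.isOpen_compl)).ne
      rw [← ENNReal.add_right_inj hne, h1, ← hF1, h2]
      ring
    · have h1 := hcompl (F ∪ U) hFU
      have h2 := hμ.union_compact F (F ∪ U)ᶜ hF.isCompact hFU.isClosed_compl.isCompact
        (disjoint_compl_right.mono_left subset_union_left)
      have h3 : F ∪ (F ∪ U)ᶜ = Uᶜ := by
        ext x
        have : x ∈ F → x ∉ U := fun h => disjoint_left.1 hd h
        simp only [mem_union, mem_compl_iff]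
        tauto
      rw [h3] at h2
      have hne := (hμ.lt_top hfin (Or.inr hFU.isClosed_compl)).ne
      rw [← ENNReal.add_left_inj hne, h1, ← hU1, h2]
      ring
  refine ⟨hμ.exists_ne_top, ?_, hμ.inner_regular, hμ.outer_regular⟩
  intro A B hA hB hAB hd
  rcases hA with hA | hA <;> rcases hB with hB | hB
  · exact hμ.union_compact A B hA hB hd
  · exact hmixed A B hA.isClosed hB (hAB.imp_left IsCompact.isClosed) hd
  · rw [union_comm] at hAB ⊢
    rw [add_comm]
    exact hmixed B A hB.isClosed hA (hAB.imp_left IsCompact.isClosed) hd.symm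
  · exact hμ.union_isOpen hA hB hd

/-- If the integral of `g` over its minimum set `{g = 1}` is given by `nMeasure`, then `μ` is
additive on this set and its complement. -/
theorem IsDeficientTopologicalMeasure.univ_le_of_integralOver_eq [T2Space X] [ConnectedSpace X]
    (hμ : IsDeficientTopologicalMeasure μ) (hfin : μ univ < ∞) (hg : Continuous g)
    (h1 : ∀ x, 1 ≤ g x) {x₀ : X} (hx₀ : ∀ x, g x ≤ g x₀)
    (h : integralOver μ g (g ⁻¹' {1}) = ∫ x in g ⁻¹' {1}, g x ∂(nMeasure μ g)) :
    μ univ ≤ μ (g ⁻¹' {1}) + μ (g ⁻¹' Ioi 1) := by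
  have hcl : IsClosed ({1} : Set ℝ) := isClosed_singleton
  have hE : IsClosed (g ⁻¹' {1}) := hcl.preimage hg
  have hφ := hμ.isInnerContinuous hfin
  have hφE := hμ.isInnerContinuous_restrict hfin (Or.inr hE)
  have := hφ.isFiniteMeasure hg h1 hx₀
  have := hφE.isFiniteMeasure hg h1 hx₀
  have huniv : g ⁻¹' Ioi 0 = univ :=
    eq_univ_of_forall fun x => zero_lt_one.trans_le (h1 x)
  set ρ := stieltjes (restrict μ (g ⁻¹' {1})) g with hρ
  have hgt : ρ (Ioi 1) = 0 := by
    rw [hρ, hφE.stieltjes_Ioi hg hx₀, ← nonpos_iff_eq_zero]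
    refine (hμ.restrict_le_stieltjes hfin hg h1 hx₀ (Or.inr hcl) 1).trans_eq ?_
    rw [singleton_inter_eq_empty.2 (by simp), measure_empty]
  -- Being concentrated at `1`, `ρ` has its total mass as its integral, so the hypothesis becomes an
  -- equality with `r({1})`.
  have hae : ∀ᵐ t ∂ρ, t = 1 := by
    filter_upwards [measure_eq_zero_iff_ae_notMem.1 hgt,
      measure_eq_zero_iff_ae_notMem.1 (hφE.stieltjes_Iio hg h1)] with t ht ht'
    exact le_antisymm (not_lt.1 ht) (not_lt.1 ht')
  have hmass : ρ univ ≤ μ (g ⁻¹' {1}) := by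
    have : ρ univ = ρ (Ioi 0) := by
      refine measure_congr ?_
      filter_upwards [hae] with t ht
      exact propext ⟨fun _ => ht ▸ zero_lt_one, fun _ => mem_univ t⟩
    rw [this, hρ, hφE.stieltjes_Ioi hg hx₀, huniv, hμ.restrict_of_isClosed hE isOpen_univ]
    exact iSup₂_le fun K hK => iSup_le fun _ =>
      hμ.mono_isClosed (hE.inter hK.isClosed) hE inter_subset_left
  have hL : integralOver μ g (g ⁻¹' {1}) = (ρ univ).toReal := by
    rw [integralOver, quasiIntegral, ← hρ, integral_congr_ae hae, integral_const, smul_eq_mul,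
      mul_one, Measure.real]
  have hR : ∫ x in g ⁻¹' {1}, g x ∂(nMeasure μ g) = (stieltjes μ g {1}).toReal := by
    rw [hμ.setIntegral_nMeasure hfin hg hx₀ (Or.inr hcl), integral_singleton, smul_eq_mul,
      mul_one, Measure.real]
  rw [hL, hR, ENNReal.toReal_eq_toReal_iff' (measure_ne_top _ _) (measure_ne_top _ _)] at h
  have hsub : Ioi (0 : ℝ) ⊆ Iio 1 ∪ ({1} ∪ Ioi 1) := fun t _ => by
    rcases lt_trichotomy t 1 with ht | ht | ht
    · exact Or.inl ht
    · exact Or.inr (Or.inl ht)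
    · exact Or.inr (Or.inr ht)
  calc μ univ = stieltjes μ g (Ioi 0) := by rw [hφ.stieltjes_Ioi hg hx₀, huniv]
    _ ≤ stieltjes μ g (Iio 1) + (stieltjes μ g {1} + stieltjes μ g (Ioi 1)) :=
        (measure_mono hsub).trans ((measure_union_le _ _).trans
          (add_le_add_right (measure_union_le _ _) _))
    _ ≤ μ (g ⁻¹' {1}) + μ (g ⁻¹' Ioi 1) := by
        rw [hφ.stieltjes_Iio hg h1, zero_add, hφ.stieltjes_Ioi hg hx₀, ← h]
        exact add_le_add_left hmass _

theorem IsDeficientTopologicalMeasure.isTopologicalMeasure_of_integralOver_eq [T2Space X]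
    [ConnectedSpace X] [CompactSpace X] (hμ : IsDeficientTopologicalMeasure μ)
    (hfin : μ univ < ∞)
    (h : ∀ g : C(X, ℝ), (∀ x, 0 ≤ g x) → ∀ C : Set ℝ, IsClosed C →
      integralOver μ g (g ⁻¹' C) = ∫ x in g ⁻¹' C, g x ∂(nMeasure μ g)) :
    IsTopologicalMeasure μ := by
  refine hμ.isTopologicalMeasure hfin fun U hU => ?_
  have hF := hU.isClosed_compl
  refine ENNReal.le_of_forall_pos_le_add fun ε hε _ => ?_
  have hlt : μ Uᶜ < μ Uᶜ + ε :=
    ENNReal.lt_add_right (hμ.lt_top hfin (Or.inr hF)).ne (by simpa using hε.ne')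
  nth_rw 1 [hμ.outer_regular _ hF] at hlt
  simp only [iInf_lt_iff, exists_prop] at hlt
  obtain ⟨V, hV, hUV, hVε⟩ := hlt
  obtain ⟨f, hf0, hf1, hf⟩ := exists_continuous_zero_one_of_isClosed hF hV.isClosed_compl
    (disjoint_compl_right.mono_left hUV)
  -- The shift by `1` makes the minimum nonzero: an integral over `{g = 0}` would carry no
  -- information about mass. Now `{g = 1} ⊆ V` and `{g > 1} ⊆ U`.
  let g : C(X, ℝ) := 1 + f
  have hgx : ∀ x, g x = 1 + f x := fun x => rfl
  have h1 : ∀ x, 1 ≤ g x := fun x => by linarith [hgx x, (hf x).1]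
  obtain ⟨x₀, -, hx₀⟩ :=
    isCompact_univ.exists_isMaxOn (univ_nonempty (α := X)) g.continuous.continuousOn
  have key := hμ.univ_le_of_integralOver_eq hfin g.continuous h1 (fun x => hx₀ (mem_univ x))
    (h g (fun x => zero_le_one.trans (h1 x)) {1} isClosed_singleton)
  have hE : μ (g ⁻¹' {1}) ≤ μ V := by
    refine hμ.le_of_isClosed (isClosed_singleton.preimage g.continuous) hV fun x hx => ?_
    by_contra hxV
    have hx1 : g x = 1 := hx
    rw [hgx, hf1 hxV, Pi.one_apply] at hx1
    norm_num at hx1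
  have hW : μ (g ⁻¹' Ioi 1) ≤ μ U := by
    refine hμ.mono_isOpen (isOpen_Ioi.preimage g.continuous) hU fun x hx => ?_
    by_contra hxU
    have hx1 : 1 < g x := hx
    rw [hgx, hf0 hxU, Pi.zero_apply] at hx1
    norm_num at hx1
  calc μ univ ≤ μ (g ⁻¹' {1}) + μ (g ⁻¹' Ioi 1) := key
    _ ≤ (μ Uᶜ + ε) + μ U := add_le_add (hE.trans hVε.le) hW
    _ = μ U + μ Uᶜ + ε := by ring

/-! ### Nonnegative functions vanishing at infinity -/

theorem isCompact_preimage_Ici (g : C₀(X, ℝ)) {s : ℝ} (hs : 0 < s) : IsCompact (g ⁻¹' Ici s) := by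
  have h : ∀ᶠ x in cocompact X, g x < s := (zero_at_infty g).eventually (Iio_mem_nhds hs)
  obtain ⟨K, hK, hKs⟩ := mem_cocompact.1 h
  refine hK.of_isClosed_subset (isClosed_Ici.preimage (map_continuous g)) fun x hx => ?_
  by_contra hxK
  have hlt : g x < s := hKs hxK
  exact hlt.not_ge hx

theorem exists_forall_le [Nonempty X] (g : C₀(X, ℝ)) (h0 : ∀ x, 0 ≤ g x) :
    ∃ x₀, ∀ x, g x ≤ g x₀ := by
  -- A positive value `g y` confines the search for a maximum to the compact set `{g ≥ g y}`;
  -- otherwise `g` is zero.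
  by_cases hpos : ∃ y, 0 < g y
  · obtain ⟨y, hy⟩ := hpos
    obtain ⟨x₀, hx₀, hmax⟩ := (isCompact_preimage_Ici g hy).exists_isMaxOn ⟨y, le_refl (g y)⟩
      (map_continuous g).continuousOn
    refine ⟨x₀, fun x => ?_⟩
    rcases le_total (g y) (g x) with h | h
    · exact hmax h
    · exact h.trans hx₀
  · push Not at hpos
    exact ⟨Classical.arbitrary X, fun x => (hpos x).trans (h0 _)⟩

end

end DTM

theorem theorem41 {X : Type*} [TopologicalSpace X] [T2Space X] [LocallyCompactSpace X]
    [ConnectedSpace X] (μ : Set X → ℝ≥0∞) (hμ : DTM.IsDeficientTopologicalMeasure μ)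
    (hfin : μ univ < ∞) :
    (∀ g : C₀(X, ℝ), (∀ x, 0 ≤ g x) →
      (∀ A : Set ℝ, IsOpen A ∨ IsClosed A →
        DTM.integralOver μ g (g ⁻¹' A) ≤ ∫ x in g ⁻¹' A, g x ∂(DTM.nMeasure μ g)) ∧
      (DTM.integralOver μ g (g ⁻¹' {0}) = 0 ∧
        (∫ x in g ⁻¹' {0}, g x ∂(DTM.nMeasure μ g)) = 0 ∧
        ∀ A : Set ℝ, IsOpen A ∨ IsClosed A → A ⊆ Iio 0 →
          DTM.integralOver μ g (g ⁻¹' A) = 0 ∧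
          (∫ x in g ⁻¹' A, g x ∂(DTM.nMeasure μ g)) = 0) ∧
      (DTM.IsTopologicalMeasure μ → ∀ A : Set ℝ, (IsClosed A ∧ A ⊆ {0}ᶜ) ∨ IsOpen A →
        DTM.integralOver μ g (g ⁻¹' A) = ∫ x in g ⁻¹' A, g x ∂(DTM.nMeasure μ g))) ∧
    (CompactSpace X →
      (DTM.IsTopologicalMeasure μ → ∀ g : C(X, ℝ), ∀ A : Set ℝ, IsOpen A ∨ IsClosed A →
        DTM.integralOver μ g (g ⁻¹' A) = ∫ x in g ⁻¹' A, g x ∂(DTM.nMeasure μ g)) ∧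
      (DTM.IsTopologicalMeasure μ ↔ ∀ g : C(X, ℝ), (∀ x, 0 ≤ g x) → ∀ C : Set ℝ, IsClosed C →
        DTM.integralOver μ g (g ⁻¹' C) = ∫ x in g ⁻¹' C, g x ∂(DTM.nMeasure μ g))) := by
  refine ⟨fun g h0 => ?_, fun _ => ⟨fun hτ g A hA => ?_, fun hτ g _ C hC => ?_, fun h => ?_⟩⟩
  · have hg : Continuous g := map_continuous g
    obtain ⟨x₀, hx₀⟩ := DTM.exists_forall_le g h0
    have hzero := hμ.integral_eq_zero_of_subset_Iic hfin hg h0 hx₀ (Or.inr isClosed_singleton)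
      (A := {0}) (by simp)
    refine ⟨fun A hA => hμ.integralOver_le hfin hg h0 hx₀ hA,
      ⟨hzero.1, hzero.2, fun A hA hA0 => ?_⟩, fun hτ A hA => ?_⟩
    · exact hμ.integral_eq_zero_of_subset_Iic hfin hg h0 hx₀ hA (hA0.trans Iio_subset_Iic_self)
    · exact hτ.integralOver_eq_of_nonneg hμ hfin hg h0 hx₀
        (fun s hs => DTM.isCompact_preimage_Ici g hs) (hA.symm.imp_right And.left)
  · exact hτ.integralOver_eq_of_compactSpace hμ hfin g.continuous hA
  · exact hτ.integralOver_eq_of_compactSpace hμ hfin g.continuous (Or.inr hC)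
  · exact hμ.isTopologicalMeasure_of_integralOver_eq hfin h
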